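/- Let $\mathcal F$ be the class of continuous distribution functions $F$ on $\mathbb R$ with $F(0)=0$ that have a probability density $f$ which is the sum of its Maclaurin series at every positive point: $$f(x)=\sum_{q=0}^{\infty}\frac{f^{(q)}(0)}{q!}\,x^q\qquad\text{for all }x>0,$$ where $f^{(q)}(0)$ denotes the $q$-th derivative at $0$ from the right. Let $n\ge 2$ and let $X_1,\dots,X_n$ be independent random variables with common distribution function $F\in\mathcal F$. If $$X_1+\tfrac12X_2+\cdots+\tfrac1nX_n\ \overset{d}{=}\ X_{(n;n)},\qquad X_{(n;n)}=\max\{X_1,\dots,X_n\},$$ then $F$ is exponential: there is $\lambda>0$ such that $F(x)=1-e^{-\lambda x}$ for all $x\ge 0$. -/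

import Mathlib

/-- `f` is a probability density of the law `μ` on `ℝ`. -/
structure IsDensity (μ : MeasureTheory.Measure ℝ) (f : ℝ → ℝ) : Prop where
  measurable : Measurable f
  nonneg : ∀ x, 0 ≤ f x
  eq_withDensity : μ = MeasureTheory.volume.withDensity (fun x => ENNReal.ofReal (f x))

/-- `f` is the sum of its Maclaurin series at every `x > 0`. The derivatives at `0` are taken from
the right (within `[0, ∞)`), since `f` usually vanishes on the negative half-line and jumps at
`0`. -/
def HasMaclaurinExpansion (f : ℝ → ℝ) : Prop :=
  ∀ x : ℝ, 0 < x →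
    HasSum (fun q : ℕ => iteratedDerivWithin q f (Set.Ici 0) 0 / (q.factorial : ℝ) * x ^ q) (f x)

/-- The class `𝓕` of laws whose distribution function `F` is continuous with `F 0 = 0` and which
have a density that is the sum of its Maclaurin series for all `x > 0`. -/
structure MemClassF (μ : MeasureTheory.Measure ℝ) : Prop where
  isProbabilityMeasure : MeasureTheory.IsProbabilityMeasure μ
  continuous_cdf : Continuous (ProbabilityTheory.cdf μ)
  cdf_zero : ProbabilityTheory.cdf μ 0 = 0
  exists_density : ∃ f : ℝ → ℝ, IsDensity μ f ∧ HasMaclaurinExpansion f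

/-- The sample maximum, i.e. the order statistic `X_(n;n)` (for `n ≥ 1`). -/
noncomputable def sampleMax {Ω : Type*} {n : ℕ} (X : Fin n → Ω → ℝ) (ω : Ω) : ℝ :=
  ⨆ i, X i ω

/-- The sum `X₁ + X₂ / 2 + ⋯ + Xₙ / n`; the sample is indexed from `0`. -/
noncomputable def harmonicSum {Ω : Type*} {n : ℕ} (X : Fin n → Ω → ℝ) (ω : Ω) : ℝ :=
  ∑ i : Fin n, X i ω / ((i : ℝ) + 1)

/-!
Let `u` be the Laplace transform of the common law, as a formal power series in `X = 1 / s`. The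
Laplace transform of the sum is then `u(X) u(2 X) ⋯ u(n X)`, and the distribution function of a law
with transform `u` has Maclaurin series `borelTransform u`, so the hypothesis says that
`borelTransform (∏ u(i X)) = (borelTransform u) ^ n`. The terms of lowest degree force `u` to have
order one. If two solutions of order one have the same two leading coefficients and first differ in
the coefficient of `X ^ (r + 1)`, then `n.multichoose (r + 1)` equals `1 ^ r + ⋯ + n ^ r`, although
it is strictly smaller when `r ≥ 2`. The transform `a X / (1 - ρ X)` of the density `a exp (ρ x)` is
a solution whose two leading coefficients `a ≠ 0` and `a ρ` are arbitrary, so every solution has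
this form, and one that comes from a probability law belongs to an exponential distribution.
-/

section Combinatorics

open Finset
open scoped Nat

theorem multichoose_lt_pow {n k : ℕ} (hn : 2 ≤ n) (hk : 2 ≤ k) : n.multichoose k < n ^ k := by
  have succ_mul (k : ℕ) : (k + 1) * n.multichoose (k + 1) = (n + k) * n.multichoose k := by
    simpa [Nat.multichoose_eq, show n + k - 1 + 1 = n + k by omega,
      show n + k - 1 - k = n - 1 by omega, mul_comm] using
      (Nat.add_one_mul_choose_eq (n + k - 1) k).symm
  induction k, hk using Nat.le_induction with
  | base =>
    have h := succ_mul 1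
    rw [Nat.multichoose_one_right] at h
    nlinarith
  | succ k hk ih =>
    refine lt_of_mul_lt_mul_left (a := k + 1) ?_ (Nat.zero_le _)
    calc (k + 1) * n.multichoose (k + 1) = (n + k) * n.multichoose k := succ_mul k
      _ < (n + k) * n ^ k := Nat.mul_lt_mul_of_pos_left ih (by omega)
      _ ≤ ((k + 1) * n) * n ^ k := Nat.mul_le_mul_right _ (by nlinarith)
      _ = (k + 1) * n ^ (k + 1) := by ring

theorem sum_range_multichoose_succ (n k : ℕ) :
    ∑ i ∈ range n, (i + 1).multichoose k = n.multichoose (k + 1) := by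
  induction n with
  | zero => simp
  | succ n ih => rw [sum_range_succ, ih, Nat.multichoose_succ_succ]

theorem multichoose_lt_sum_range_pow {n k : ℕ} (hn : 2 ≤ n) (hk : 2 ≤ k) :
    n.multichoose (k + 1) < ∑ i ∈ range n, (i + 1) ^ k := by
  rw [← sum_range_multichoose_succ]
  refine sum_lt_sum (fun i _ => ?_) ⟨1, mem_range.2 hn, multichoose_lt_pow le_rfl hk⟩
  rcases i.eq_zero_or_pos with rfl | hi
  · simp
  · exact (multichoose_lt_pow (by omega) hk).le

theorem multichoose_mul_factorial_mul_factorial (n k : ℕ) :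
    n.multichoose (k + 1) * (n ! * (k + 1)!) = n * (n + k)! := by
  calc n.multichoose (k + 1) * (n ! * (k + 1)!)
      = n ! * n.ascFactorial (k + 1) := by
        rw [Nat.ascFactorial_eq_factorial_mul_choose', Nat.multichoose_eq]; ring
    _ = n * (n + k)! := by
        rw [Nat.ascFactorial_succ, ← Nat.succ_ascFactorial, mul_left_comm,
          Nat.factorial_mul_ascFactorial]

theorem succ_pow_mul_factorial_lt_ascFactorial {k n : ℕ} (hk : 0 < k) (hn : 2 ≤ n) :
    (k + 1) ^ n * n ! < (k * n + 1).ascFactorial n := by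
  rw [← prod_range_add_one_eq_factorial, Nat.ascFactorial_eq_prod_range,
    ← card_range n, ← prod_const, card_range, ← prod_mul_distrib]
  refine prod_lt_prod (fun i _ => by positivity) (fun i hi => ?_) ⟨0, mem_range.2 (by omega), ?_⟩
  · nlinarith [mem_range.1 hi]
  · nlinarith

theorem factorial_pow_mul_factorial_pow_lt {k n : ℕ} (hk : 2 ≤ k) (hn : 2 ≤ n) :
    n ! ^ k * k ! ^ n < (k * n)! := by
  have factorial_succ_mul (k : ℕ) : ((k + 1) * n)! = (k * n)! * (k * n + 1).ascFactorial n := by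
    rw [Nat.factorial_mul_ascFactorial, Nat.add_one_mul]
  have pow_mul_factorial_pow_succ (k : ℕ) :
      n ! ^ (k + 1) * (k + 1)! ^ n = n ! ^ k * k ! ^ n * ((k + 1) ^ n * n !) := by
    rw [Nat.factorial_succ, mul_pow, pow_succ]; ring
  induction k, hk using Nat.le_induction with
  | base =>
    rw [factorial_succ_mul, pow_mul_factorial_pow_succ]
    simpa using Nat.mul_lt_mul_of_pos_left
      (succ_pow_mul_factorial_lt_ascFactorial one_pos hn) n.factorial_pos
  | succ k hk ih =>
    rw [factorial_succ_mul, pow_mul_factorial_pow_succ]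
    exact Nat.mul_lt_mul'' ih (succ_pow_mul_factorial_lt_ascFactorial (by omega) hn)

end Combinatorics

section FormalSeries

open PowerSeries
open scoped Nat

variable {K : Type*} [Field K]

theorem constantCoeff_rescale {R : Type*} [CommSemiring R] (b : R) (u : R⟦X⟧) :
    constantCoeff (rescale b u) = constantCoeff u := by
  rw [← coeff_zero_eq_constantCoeff_apply, coeff_rescale, pow_zero, one_mul,
    coeff_zero_eq_constantCoeff_apply]

theorem rescale_C {R : Type*} [CommSemiring R] (b c : R) : rescale b (C c) = C c := by
  ext m
  rcases m with - | m <;> simp [coeff_C]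

/-- The formal Borel transform `∑ uₘ Xᵐ ↦ ∑ uₘ / m! Xᵐ`. -/
noncomputable def borelTransform : K⟦X⟧ →ₗ[K] K⟦X⟧ where
  toFun u := .mk fun m => coeff m u / (m ! : K)
  map_add' u v := by ext m; simp only [coeff_mk, map_add, add_div]
  map_smul' c u := by ext m; simp [mul_div_assoc]

@[simp]
theorem coeff_borelTransform (m : ℕ) (u : K⟦X⟧) :
    coeff m (borelTransform u) = coeff m u / (m ! : K) :=
  coeff_mk m fun m => coeff m u / (m ! : K)

@[simp]
theorem constantCoeff_borelTransform (u : K⟦X⟧) :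
    constantCoeff (borelTransform u) = constantCoeff u := by
  rw [← coeff_zero_eq_constantCoeff_apply, coeff_borelTransform, Nat.factorial_zero, Nat.cast_one,
    div_one, coeff_zero_eq_constantCoeff_apply]

theorem borelTransform_C_mul (c : K) (u : K⟦X⟧) :
    borelTransform (C c * u) = C c * borelTransform u := by
  simp only [← smul_eq_C_mul, map_smul]

theorem borelTransform_C (c : K) : borelTransform (C c) = C c := by
  ext m
  rcases m with - | m <;> simp [coeff_C]

theorem borelTransform_rescale (c : K) (u : K⟦X⟧) :
    borelTransform (rescale c u) = rescale c (borelTransform u) := by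
  ext m
  simp only [coeff_borelTransform, coeff_rescale, mul_div_assoc]

theorem borelTransform_X_pow_mul (k : ℕ) (u : K⟦X⟧) :
    borelTransform (X ^ k * u) = X ^ k * .mk fun m => coeff m u / ((m + k)! : K) := by
  ext m
  simp only [coeff_borelTransform, coeff_X_pow_mul']
  split_ifs with h
  · rw [coeff_mk, Nat.sub_add_cancel h]
  · exact zero_div _

theorem derivative_borelTransform_X_mul [CharZero K] (u : K⟦X⟧) :
    d⁄dX K (borelTransform (X * u)) = borelTransform u := by
  ext m
  have : (m : K) + 1 ≠ 0 := m.cast_add_one_ne_zero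
  rw [coeff_derivative, coeff_borelTransform, coeff_succ_X_mul, coeff_borelTransform,
    Nat.factorial_succ]
  push_cast
  field_simp

theorem eq_of_derivative_eq_add_C_mul [CharZero K] {c : K} {e f g : K⟦X⟧}
    (hf : d⁄dX K f = e + C c * f) (hg : d⁄dX K g = e + C c * g)
    (h0 : constantCoeff f = constantCoeff g) : f = g := by
  ext m
  induction m with
  | zero => simpa using h0
  | succ m ih =>
    have hderiv : coeff m (d⁄dX K f) = coeff m (d⁄dX K g) := by
      rw [hf, hg, map_add, map_add, coeff_C_mul, coeff_C_mul, ih]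
    rw [coeff_derivative, coeff_derivative] at hderiv
    exact mul_right_cancel₀ m.cast_add_one_ne_zero hderiv

/-- The series `a X / (1 - ρ X)`: the formal Laplace transform, in the variable `X = 1 / s`, of the
function `x ↦ a exp (ρ x)`. -/
noncomputable def expLaplaceSeries (a ρ : K) : K⟦X⟧ :=
  X * (C a * .mk fun m => ρ ^ m)

theorem coeff_succ_expLaplaceSeries (a ρ : K) (m : ℕ) :
    coeff (m + 1) (expLaplaceSeries a ρ) = a * ρ ^ m := by
  rw [expLaplaceSeries, coeff_succ_X_mul, coeff_C_mul, coeff_mk]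

theorem constantCoeff_expLaplaceSeries (a ρ : K) : constantCoeff (expLaplaceSeries a ρ) = 0 := by
  simp [expLaplaceSeries]

theorem expLaplaceSeries_eq_X_mul (a ρ : K) :
    expLaplaceSeries a ρ = X * (C a + C ρ * expLaplaceSeries a ρ) := by
  ext m
  rcases m with - | - | m
  · simp [constantCoeff_expLaplaceSeries]
  · simp [coeff_succ_X_mul, coeff_succ_expLaplaceSeries, constantCoeff_expLaplaceSeries]
  · rw [coeff_succ_X_mul, map_add, coeff_C_mul, coeff_succ_expLaplaceSeries,
      coeff_succ_expLaplaceSeries, coeff_succ_C]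
    ring

theorem borelTransform_expLaplaceSeries [Algebra ℚ K] (a ρ : K) :
    C a + C ρ * borelTransform (expLaplaceSeries a ρ) = C a * rescale ρ (exp K) := by
  ext m
  rcases m with - | m
  · simp [constantCoeff_expLaplaceSeries]
  · simp only [map_add, coeff_succ_C, coeff_C_mul, coeff_borelTransform,
      coeff_succ_expLaplaceSeries, coeff_rescale, coeff_exp, map_div₀, map_one, map_natCast]
    ring

/-- The product `u(X) u(2 X) ⋯ u(n X)`: the formal Laplace transform of `X₁ + X₂ / 2 + ⋯ + Xₙ / n`
when `u` is that of each `Xᵢ`, in the variable `X = 1 / s`. -/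
noncomputable def harmonicProd (n : ℕ) (u : K⟦X⟧) : K⟦X⟧ :=
  ∏ i ∈ Finset.range n, rescale ((i : K) + 1) u

theorem harmonicProd_succ (n : ℕ) (u : K⟦X⟧) :
    harmonicProd (n + 1) u = harmonicProd n u * rescale ((n : K) + 1) u :=
  Finset.prod_range_succ _ n

theorem constantCoeff_harmonicProd (n : ℕ) (u : K⟦X⟧) :
    constantCoeff (harmonicProd n u) = constantCoeff u ^ n := by
  simp [harmonicProd, constantCoeff_rescale]

theorem harmonicProd_X_pow_mul (n k : ℕ) (u : K⟦X⟧) :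
    harmonicProd n (X ^ k * u) = X ^ (k * n) * (C ((n ! : K) ^ k) * harmonicProd n u) := by
  have factorial_eq : (n ! : K) = ∏ i ∈ Finset.range n, ((i : K) + 1) := by
    simp [← Finset.prod_range_add_one_eq_factorial]
  simp only [harmonicProd, map_mul, map_pow, rescale_X, Finset.prod_mul_distrib, factorial_eq,
    map_prod, Finset.prod_pow, Finset.prod_const, Finset.card_range]
  ring

theorem harmonicProd_succ_expLaplaceSeries (n : ℕ) (a ρ : K) :
    harmonicProd (n + 1) (expLaplaceSeries a ρ) =
      X * (C ((n : K) + 1) * (C a * harmonicProd n (expLaplaceSeries a ρ) +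
        C ρ * harmonicProd (n + 1) (expLaplaceSeries a ρ))) := by
  have rescale_eq := congrArg (rescale ((n : K) + 1)) (expLaplaceSeries_eq_X_mul a ρ)
  rw [map_mul, map_add, map_mul, rescale_X, rescale_C, rescale_C] at rescale_eq
  rw [harmonicProd_succ]
  nth_rw 1 [rescale_eq]
  ring

/-- The formal counterpart of `X₁ + X₂ / 2 + ⋯ + Xₙ / n` being distributed as the maximum of
`X₁, …, Xₙ`: if `u` is the formal Laplace transform of the common law in the variable `X = 1 / s`,
then `borelTransform u` is the Maclaurin series of its distribution function. -/
def RenyiIdentity (n : ℕ) (u : K⟦X⟧) : Prop :=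
  borelTransform (harmonicProd n u) = borelTransform u ^ n

-- Both sides solve `dy/dX = (n + 1) (a y₀ + ρ y)`, where `y₀` is their common value for `n`.
theorem renyiIdentity_expLaplaceSeries [CharZero K] (n : ℕ) (a ρ : K) :
    RenyiIdentity n (expLaplaceSeries a ρ) := by
  induction n with
  | zero => simpa [RenyiIdentity, harmonicProd] using borelTransform_C (1 : K)
  | succ n ih =>
    have derivative_borel : d⁄dX K (borelTransform (expLaplaceSeries a ρ)) =
        C a + C ρ * borelTransform (expLaplaceSeries a ρ) := by
      conv_lhs => rw [expLaplaceSeries_eq_X_mul, derivative_borelTransform_X_mul, map_add,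
        borelTransform_C, borelTransform_C_mul]
    refine eq_of_derivative_eq_add_C_mul (c := ((n : K) + 1) * ρ)
      (e := C (((n : K) + 1) * a) * borelTransform (expLaplaceSeries a ρ) ^ n) ?_ ?_ ?_
    · conv_lhs => rw [harmonicProd_succ_expLaplaceSeries]
      rw [derivative_borelTransform_X_mul, borelTransform_C_mul, LinearMap.map_add,
        borelTransform_C_mul, borelTransform_C_mul, ih]
      simp only [map_mul]
      ring
    · rw [derivative_pow, derivative_borel]
      simp only [map_mul, map_add, map_natCast, map_one, Nat.cast_add, Nat.cast_one,
        add_tsub_cancel_right]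
      ring
    · rw [constantCoeff_borelTransform, constantCoeff_harmonicProd, map_pow,
        constantCoeff_borelTransform]

theorem coeff_mul_eq_of_X_pow_dvd {R : Type*} [CommSemiring R] {r : ℕ} {p d : R⟦X⟧}
    (hd : X ^ r ∣ d) : coeff r (d * p) = coeff r d * constantCoeff p := by
  obtain ⟨e, rfl⟩ := hd
  simp [mul_assoc, coeff_X_pow_mul']

theorem X_pow_dvd_prod_sub_prod {R ι : Type*} [CommRing R] {s : Finset ι} {r : ℕ}
    {u v : ι → R⟦X⟧} (huv : ∀ i ∈ s, X ^ r ∣ u i - v i) : X ^ r ∣ ∏ i ∈ s, u i - ∏ i ∈ s, v i := by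
  simp only [← Ideal.mem_span_singleton, ← Ideal.Quotient.mk_eq_mk_iff_sub_mem, map_prod] at huv ⊢
  exact Finset.prod_congr rfl huv

/- Multiplying by `c` avoids the truncated exponent `#s - 1`. -/
theorem mul_coeff_prod_sub_prod {R ι : Type*} [CommRing R] {s : Finset ι} {r : ℕ}
    {u v : ι → R⟦X⟧} {c : R} (huv : ∀ i ∈ s, X ^ r ∣ u i - v i)
    (hu : ∀ i ∈ s, constantCoeff (u i) = c) (hv : ∀ i ∈ s, constantCoeff (v i) = c) :
    c * coeff r (∏ i ∈ s, u i - ∏ i ∈ s, v i) = c ^ s.card * ∑ i ∈ s, coeff r (u i - v i) := by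
  classical
  induction s using Finset.induction_on with
  | empty => simp
  | insert i s hi ih =>
    simp only [Finset.forall_mem_insert] at huv hu hv
    have telescope : ∏ j ∈ insert i s, u j - ∏ j ∈ insert i s, v j =
        (u i - v i) * ∏ j ∈ s, u j + (∏ j ∈ s, u j - ∏ j ∈ s, v j) * v i := by
      rw [Finset.prod_insert hi, Finset.prod_insert hi]
      ring
    rw [telescope, map_add, coeff_mul_eq_of_X_pow_dvd huv.1,
      coeff_mul_eq_of_X_pow_dvd (X_pow_dvd_prod_sub_prod huv.2), map_prod,
      Finset.prod_congr rfl hu.2, Finset.prod_const, hv.1, Finset.sum_insert hi,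
      Finset.card_insert_of_notMem hi, mul_add, mul_add, ← mul_assoc c _ c, ih huv.2 hu.2 hv.2]
    ring

theorem X_pow_dvd_rescale {R : Type*} [CommSemiring R] {r : ℕ} {u : R⟦X⟧} (hu : X ^ r ∣ u) (b : R) :
    X ^ r ∣ rescale b u := by
  simp only [X_pow_dvd_iff, coeff_rescale] at hu ⊢
  intro m hm
  rw [hu m hm, mul_zero]

theorem RenyiIdentity.coeff_pow {n k : ℕ} {w : K⟦X⟧} (h : RenyiIdentity n (X ^ k * w)) (r : ℕ) :
    coeff r ((.mk fun m => coeff m w / ((m + k)! : K)) ^ n) =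
      (n ! : K) ^ k / ((r + k * n)! : K) * coeff r (harmonicProd n w) := by
  have hcoeff := congrArg (coeff (r + k * n)) h
  rw [harmonicProd_X_pow_mul, borelTransform_X_pow_mul, borelTransform_X_pow_mul, mul_pow,
    ← pow_mul, coeff_X_pow_mul, coeff_X_pow_mul, coeff_mk, coeff_C_mul] at hcoeff
  rw [← hcoeff]
  ring

-- Comparing the coefficients of lowest degree of both sides gives `n !^k * k !^n = (k * n)!`.
theorem RenyiIdentity.coeff_one_ne_zero [CharZero K] {n : ℕ} (hn : 2 ≤ n) {u : K⟦X⟧}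
    (h : RenyiIdentity n u) (h0 : constantCoeff u = 0) (hu : u ≠ 0) : coeff 1 u ≠ 0 := by
  obtain ⟨k, w, rfl, hw⟩ : ∃ k w, u = X ^ k * w ∧ constantCoeff w ≠ 0 :=
    ⟨u.order.toNat, u.divXPowOrder, X_pow_order_mul_divXPowOrder.symm,
      constantCoeff_divXPowOrder_eq_zero_iff.not.2 hu⟩
  have hk : k = 1 := by
    have hlead : constantCoeff w ^ n * ((k ! ^ n : ℕ) : K)⁻¹ =
        constantCoeff w ^ n * ((n ! ^ k : ℕ) / ((k * n)! : ℕ)) := by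
      have := h.coeff_pow 0
      rw [coeff_zero_eq_constantCoeff_apply, coeff_zero_eq_constantCoeff_apply, map_pow,
        constantCoeff_harmonicProd, constantCoeff_mk, zero_add, zero_add, div_pow] at this
      simpa [div_eq_mul_inv, mul_comm] using this
    have hfactorial : n ! ^ k * k ! ^ n = (k * n)! := by
      have := mul_left_cancel₀ (pow_ne_zero n hw) hlead
      rw [inv_eq_iff_eq_inv, inv_div, eq_div_iff (by simp [Nat.factorial_ne_zero])] at this
      exact_mod_cast (mul_comm _ _).trans this
    have hk0 : k ≠ 0 := by
      rintro rfl
      simp [hw] at h0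
    by_contra hk1
    exact (factorial_pow_mul_factorial_pow_lt (by omega) hn).ne hfactorial
  subst hk
  simpa using hw

theorem mul_coeff_harmonicProd_sub {n r : ℕ} {u v : K⟦X⟧} (huv : X ^ r ∣ u - v)
    (h0 : constantCoeff u = constantCoeff v) :
    constantCoeff u * coeff r (harmonicProd n u - harmonicProd n v) =
      constantCoeff u ^ n * ((∑ i ∈ Finset.range n, (i + 1) ^ r : ℕ) * coeff r (u - v)) := by
  have := mul_coeff_prod_sub_prod (s := Finset.range n) (c := constantCoeff u)
    (fun i _ => (rescale ((i : K) + 1)).map_sub u v ▸ X_pow_dvd_rescale huv ((i : K) + 1))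
    (fun i _ => constantCoeff_rescale _ u) (fun i _ => h0 ▸ constantCoeff_rescale _ v)
  rw [Finset.card_range] at this
  rw [harmonicProd, harmonicProd, this]
  simp [coeff_rescale, ← mul_sub, Finset.sum_mul]

theorem mul_coeff_pow_sub_pow {n r : ℕ} {u v : K⟦X⟧} (huv : X ^ r ∣ u - v)
    (h0 : constantCoeff u = constantCoeff v) :
    constantCoeff u * coeff r (u ^ n - v ^ n) =
      constantCoeff u ^ n * (n * coeff r (u - v)) := by
  simpa [mul_sub] using mul_coeff_prod_sub_prod (s := Finset.range n) (fun _ _ => huv)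
    (fun _ _ => rfl) (fun _ _ => h0.symm)

theorem RenyiIdentity.multichoose_mul_coeff_sub [CharZero K] {n r : ℕ} {u v : K⟦X⟧}
    (hu : RenyiIdentity n (X * u)) (hv : RenyiIdentity n (X * v)) (huv : X ^ r ∣ u - v)
    (h0 : constantCoeff u = constantCoeff v) (hu0 : constantCoeff u ≠ 0) :
    n.multichoose (r + 1) * coeff r (u - v) =
      (∑ i ∈ Finset.range n, (i + 1) ^ r : ℕ) * coeff r (u - v) := by
  set T : K⟦X⟧ → K⟦X⟧ := fun w => .mk fun m => coeff m w / ((m + 1)! : K)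
  have constantCoeff_T (w : K⟦X⟧) : constantCoeff (T w) = constantCoeff w := by simp [T]
  have coeff_T_sub (m : ℕ) : coeff m (T u - T v) = coeff m (u - v) / ((m + 1)! : K) := by
    simp only [T, map_sub, coeff_mk, sub_div]
  have hT : X ^ r ∣ T u - T v := X_pow_dvd_iff.2 fun m hm => by
    rw [coeff_T_sub, X_pow_dvd_iff.1 huv m hm, zero_div]
  have hpow := mul_coeff_pow_sub_pow (n := n) hT (by simpa only [constantCoeff_T] using h0)
  have hprod := mul_coeff_harmonicProd_sub (n := n) huv h0
  have hu_coeff := RenyiIdentity.coeff_pow (k := 1) (by simpa using hu) r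
  have hv_coeff := RenyiIdentity.coeff_pow (k := 1) (by simpa using hv) r
  have hdiff : coeff r (T u ^ n - T v ^ n) =
      (n ! : K) / ((n + r)! : K) * coeff r (harmonicProd n u - harmonicProd n v) := by
    rw [map_sub, hu_coeff, hv_coeff, pow_one, one_mul, add_comm r n, ← mul_sub, ← map_sub]
  have hmultichoose : (n.multichoose (r + 1) : K) * (n ! * (r + 1)!) = n * (n + r)! := by
    exact_mod_cast multichoose_mul_factorial_mul_factorial n r
  rw [constantCoeff_T, hdiff, mul_left_comm, hprod, coeff_T_sub, mul_left_comm] at hpow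
  have hcancel := mul_left_cancel₀ (pow_ne_zero n hu0) hpow
  have hnr : ((n + r)! : K) ≠ 0 := mod_cast (n + r).factorial_ne_zero
  have hr : ((r + 1)! : K) ≠ 0 := mod_cast (r + 1).factorial_ne_zero
  have hn : (n ! : K) ≠ 0 := mod_cast n.factorial_ne_zero
  field_simp at hcancel
  refine mul_left_cancel₀ (mul_ne_zero hn hr) ?_
  linear_combination coeff r (u - v) * hmultichoose - hcancel

/- If `u` and `v` first differ in degree `r`, then `n.multichoose (r + 1)` equals
`∑ i ∈ range n, (i + 1) ^ r`, which is only possible for `r ≤ 1`. -/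
theorem RenyiIdentity.eq_of_coeff_eq [CharZero K] {n : ℕ} (hn : 2 ≤ n) {u v : K⟦X⟧}
    (hu : RenyiIdentity n (X * u)) (hv : RenyiIdentity n (X * v)) (hu0 : constantCoeff u ≠ 0)
    (h0 : constantCoeff u = constantCoeff v) (h1 : coeff 1 u = coeff 1 v) : u = v := by
  ext r
  induction r using Nat.strong_induction_on with | h r ih => ?_
  rcases (by omega : r = 0 ∨ r = 1 ∨ 2 ≤ r) with rfl | rfl | hr
  · simpa only [coeff_zero_eq_constantCoeff] using h0
  · exact h1
  have huv : X ^ r ∣ u - v := X_pow_dvd_iff.2 fun m hm => by rw [map_sub, ih m hm, sub_self]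
  rw [← sub_eq_zero, ← map_sub]
  by_contra hne
  have := mul_right_cancel₀ hne (hu.multichoose_mul_coeff_sub hv huv h0 hu0)
  exact (multichoose_lt_sum_range_pow hn hr).ne (by exact_mod_cast this)

theorem RenyiIdentity.exists_eq_expLaplaceSeries [CharZero K] {n : ℕ} (hn : 2 ≤ n) {u : K⟦X⟧}
    (h : RenyiIdentity n u) (h0 : constantCoeff u = 0) : ∃ a ρ, u = expLaplaceSeries a ρ := by
  rcases eq_or_ne u 0 with rfl | hu
  · exact ⟨0, 0, by simp [expLaplaceSeries]⟩
  have h1 := h.coeff_one_ne_zero hn h0 hu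
  obtain ⟨w, rfl⟩ := X_dvd_iff.2 h0
  have hw : constantCoeff w ≠ 0 := by simpa using h1
  refine ⟨constantCoeff w, coeff 1 w / constantCoeff w, congrArg (X * ·) ?_⟩
  refine h.eq_of_coeff_eq hn (renyiIdentity_expLaplaceSeries n _ _) hw ?_ ?_
  · simp
  · rw [coeff_C_mul, coeff_mk, pow_one, mul_div_cancel₀ _ hw]

end FormalSeries

section ConvergentSeries

open PowerSeries
open scoped Nat

/-- The power series `u` converges to `F` at every point of the half-line `[0, ∞)`. -/
def SumsTo (u : ℝ⟦X⟧) (F : ℝ → ℝ) : Prop :=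
  ∀ x : ℝ, 0 ≤ x → HasSum (fun m => coeff m u * x ^ m) (F x)

theorem hasSum_sum_antidiagonal {α : Type*} [AddCommMonoid α] [TopologicalSpace α]
    [ContinuousAdd α] [RegularSpace α] {f : ℕ × ℕ → α} {a : α} (h : HasSum f a) :
    HasSum (fun m => ∑ p ∈ Finset.HasAntidiagonal.antidiagonal m, f p) a :=
  ((Finset.HasAntidiagonal.sigmaAntidiagonalEquivProd (A := ℕ)).hasSum_iff.2 h).sigma fun m =>
    Finset.hasSum (Finset.HasAntidiagonal.antidiagonal m) f

theorem hasSum_mul_prod {ι κ : Type*} {f : ι → ℝ} {g : κ → ℝ} {a b : ℝ} (hf : HasSum f a)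
    (hg : HasSum g b) : HasSum (fun p : ι × κ => f p.1 * g p.2) (a * b) :=
  hf.mul hg (summable_mul_of_summable_norm hf.summable.norm hg.summable.norm)

theorem SumsTo.congr {u : ℝ⟦X⟧} {F G : ℝ → ℝ} (hu : SumsTo u F) (h : ∀ x, 0 ≤ x → F x = G x) :
    SumsTo u G :=
  fun x hx => h x hx ▸ hu x hx

theorem sumsTo_C (c : ℝ) : SumsTo (C c) fun _ => c := by
  intro x _
  convert hasSum_single (f := fun m => coeff m (C c) * x ^ m) 0 fun m hm => ?_
  · simp
  · simp [coeff_C, hm]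

theorem SumsTo.add {u v : ℝ⟦X⟧} {F G : ℝ → ℝ} (hu : SumsTo u F) (hv : SumsTo v G) :
    SumsTo (u + v) fun x => F x + G x := by
  intro x hx
  simpa only [map_add, add_mul] using (hu x hx).add (hv x hx)

theorem SumsTo.sub {u v : ℝ⟦X⟧} {F G : ℝ → ℝ} (hu : SumsTo u F) (hv : SumsTo v G) :
    SumsTo (u - v) fun x => F x - G x := by
  intro x hx
  simpa only [map_sub, sub_mul] using (hu x hx).sub (hv x hx)

theorem SumsTo.mul {u v : ℝ⟦X⟧} {F G : ℝ → ℝ} (hu : SumsTo u F) (hv : SumsTo v G) :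
    SumsTo (u * v) fun x => F x * G x := by
  intro x hx
  convert! hasSum_sum_antidiagonal (hasSum_mul_prod (hu x hx) (hv x hx)) using 2 with m
  rw [coeff_mul, Finset.sum_mul]
  refine Finset.sum_congr rfl fun p hp => ?_
  rw [← Finset.HasAntidiagonal.mem_antidiagonal.1 hp, pow_add]
  ring

theorem SumsTo.C_mul {u : ℝ⟦X⟧} {F : ℝ → ℝ} (hu : SumsTo u F) (c : ℝ) :
    SumsTo (C c * u) fun x => c * F x :=
  (sumsTo_C c).mul hu

theorem SumsTo.pow {u : ℝ⟦X⟧} {F : ℝ → ℝ} (hu : SumsTo u F) (n : ℕ) :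
    SumsTo (u ^ n) fun x => F x ^ n := by
  induction n with
  | zero => simpa using sumsTo_C 1
  | succ n ih => simpa only [pow_succ] using ih.mul hu

theorem SumsTo.rescale {u : ℝ⟦X⟧} {F : ℝ → ℝ} (hu : SumsTo u F) {c : ℝ} (hc : 0 ≤ c) :
    SumsTo (PowerSeries.rescale c u) fun x => F (c * x) := by
  intro x hx
  convert hu (c * x) (mul_nonneg hc hx) using 2 with m
  rw [coeff_rescale, mul_pow]
  ring

theorem sumsTo_rescale_exp (ρ : ℝ) :
    SumsTo (PowerSeries.rescale ρ (exp ℝ)) fun x => Real.exp (ρ * x) := by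
  intro x _
  rw [Real.exp_eq_exp_ℝ]
  convert! NormedSpace.expSeries_div_hasSum_exp (ρ * x) using 2 with m
  rw [coeff_rescale, coeff_exp, mul_pow, map_div₀, map_one, map_natCast]
  ring

theorem SumsTo.eq_zero {u : ℝ⟦X⟧} (hu : SumsTo u 0) : u = 0 := by
  set p := FormalMultilinearSeries.ofScalars ℝ fun m => coeff m u with hp
  have hradius : 0 < p.radius := by
    refine one_pos.trans_le (p.le_radius_of_summable_norm (r := 1) ?_)
    simpa [hp, FormalMultilinearSeries.ofScalars_norm] using (hu 1 zero_le_one).summable.norm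
  have hseries := p.hasFPowerSeriesOnBall hradius
  have hzero (x : ℝ) (hx : 0 < x) : p.sum x = 0 := by
    rw [FormalMultilinearSeries.sum, ← Pi.zero_apply (M := fun _ => ℝ) x, ← (hu x hx.le).tsum_eq]
    simp [hp, mul_comm]
  have hfrequently : ∃ᶠ x in nhdsWithin (0 : ℝ) {0}ᶜ, p.sum x = 0 :=
    (eventually_nhdsWithin_of_forall (s := Set.Ioi 0) hzero).frequently.filter_mono
      (nhdsWithin_mono _ fun x hx => ne_of_gt hx)
  have hp0 : p = 0 := hseries.hasFPowerSeriesAt.eq_zero_of_eventually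
    (hseries.analyticAt.frequently_zero_iff_eventually_zero.1 hfrequently)
  ext m
  exact congrFun ((FormalMultilinearSeries.ofScalars_series_eq_zero ℝ).1 hp0) m

theorem SumsTo.unique {u v : ℝ⟦X⟧} {F : ℝ → ℝ} (hu : SumsTo u F) (hv : SumsTo v F) : u = v :=
  sub_eq_zero.1 ((hu.sub hv).congr fun x _ => sub_self (F x)).eq_zero

theorem integral_sub_pow_mul_pow (x : ℝ) (p q : ℕ) :
    ∫ y in (0 : ℝ)..x, (x - y) ^ p / p ! * (y ^ q / q !) = x ^ (p + q + 1) / (p + q + 1)! := by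
  have hasDerivAt_pow_div (m : ℕ) (y : ℝ) :
      HasDerivAt (fun y : ℝ => y ^ (m + 1) / (m + 1)!) (y ^ m / m !) y := by
    convert! (hasDerivAt_pow (m + 1) y).div_const ((m + 1)! : ℝ) using 1
    rw [Nat.factorial_succ]
    push_cast
    field_simp
  induction p generalizing q with
  | zero =>
    have h := intervalIntegral.integral_eq_sub_of_hasDerivAt (a := 0) (b := x)
      (fun y _ => hasDerivAt_pow_div q y) (Continuous.intervalIntegrable (by fun_prop) _ _)
    simpa using h
  | succ p ih =>
    have hsub (y : ℝ) : HasDerivAt (fun y => (x - y) ^ (p + 1) / (p + 1)!)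
        (-((x - y) ^ p / p !)) y := by
      simpa [Function.comp_def] using
        (hasDerivAt_pow_div p (x - y)).comp y ((hasDerivAt_id y).const_sub x)
    have hparts := intervalIntegral.integral_mul_deriv_eq_deriv_mul (a := 0) (b := x)
      (fun y _ => hsub y) (fun y _ => hasDerivAt_pow_div q y)
      (Continuous.intervalIntegrable (by fun_prop) _ _)
      (Continuous.intervalIntegrable (by fun_prop) _ _)
    rw [hparts]
    simp only [neg_mul, intervalIntegral.integral_neg, ih]
    simp [show p + (q + 1) + 1 = p + 1 + q + 1 by omega]

theorem SumsTo.hasSum_integral_sub_mul {u v : ℝ⟦X⟧} {F G : ℝ → ℝ} (hu : SumsTo u F)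
    (hv : SumsTo v G) {x : ℝ} (hx : 0 ≤ x) :
    HasSum (fun p : ℕ × ℕ => ∫ y in (0 : ℝ)..x,
        coeff p.1 u * (x - y) ^ p.1 * (coeff p.2 v * y ^ p.2))
      (∫ y in (0 : ℝ)..x, F (x - y) * G y) := by
  have summable_bound {w : ℝ⟦X⟧} {H : ℝ → ℝ} (hw : SumsTo w H) :
      Summable fun m => ‖coeff m w‖ * x ^ m := by
    simpa only [norm_mul, norm_pow, Real.norm_of_nonneg hx] using (hw x hx).summable.norm
  refine intervalIntegral.hasSum_integral_of_dominated_convergence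
    (fun p _ => ‖coeff p.1 u‖ * x ^ p.1 * (‖coeff p.2 v‖ * x ^ p.2))
    (fun p => Continuous.aestronglyMeasurable (by fun_prop)) ?_ ?_ intervalIntegrable_const ?_
  · refine fun p => .of_forall fun y hy => ?_
    rw [Set.uIoc_of_le hx] at hy
    obtain ⟨hy0, hyx⟩ : 0 ≤ y ∧ y ≤ x := ⟨hy.1.le, hy.2⟩
    simp only [norm_mul, norm_pow, Real.norm_of_nonneg (sub_nonneg.2 hyx), Real.norm_of_nonneg hy0]
    have : 0 ≤ x - y := sub_nonneg.2 hyx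
    gcongr
    exact sub_le_self x hy0
  · exact .of_forall fun y _ => (summable_bound hu).mul_of_nonneg (summable_bound hv)
      (fun _ => by positivity) (fun _ => by positivity)
  · refine .of_forall fun y hy => ?_
    rw [Set.uIoc_of_le hx] at hy
    exact (hasSum_mul_prod (hu (x - y) (sub_nonneg.2 hy.2)) (hv y hy.1.le) :)

theorem SumsTo.borelTransform_X_mul_mul {u v : ℝ⟦X⟧} {F G : ℝ → ℝ}
    (hu : SumsTo (borelTransform u) F) (hv : SumsTo (borelTransform v) G) :
    SumsTo (borelTransform (X * (u * v))) fun x => ∫ y in (0 : ℝ)..x, F (x - y) * G y := by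
  intro x hx
  refine (hasSum_nat_add_iff' 1).1 ?_
  convert! hasSum_sum_antidiagonal (hu.hasSum_integral_sub_mul hv hx) using 2 with m
  · rw [coeff_borelTransform, coeff_succ_X_mul, coeff_mul, Finset.sum_div, Finset.sum_mul]
    refine Finset.sum_congr rfl fun p hp => ?_
    have integrand_eq (y : ℝ) : coeff p.1 (borelTransform u) * (x - y) ^ p.1 *
        (coeff p.2 (borelTransform v) * y ^ p.2) =
        coeff p.1 u * coeff p.2 v * ((x - y) ^ p.1 / p.1 ! * (y ^ p.2 / p.2 !)) := by
      rw [coeff_borelTransform, coeff_borelTransform]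
      ring
    simp only [integrand_eq]
    rw [intervalIntegral.integral_const_mul, integral_sub_pow_mul_pow,
      Finset.HasAntidiagonal.mem_antidiagonal.1 hp]
    ring
  · simp

end ConvergentSeries

section Laws

open MeasureTheory ProbabilityTheory Filter Topology PowerSeries

theorem conv_apply {M : Type*} [AddMonoid M] [MeasurableSpace M] [MeasurableAdd₂ M]
    (μ ν : Measure M) [SFinite μ] [SFinite ν] {s : Set M} (hs : MeasurableSet s) :
    (μ ∗ ν) s = ∫⁻ y, μ ((· + y) ⁻¹' s) ∂ν := by
  rw [Measure.conv, Measure.map_apply measurable_add hs,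
    Measure.prod_apply_symm (measurable_add hs)]
  rfl

theorem measureReal_conv_Iic (μ ν : Measure ℝ) [IsFiniteMeasure μ] [SFinite ν] (x : ℝ) :
    (μ ∗ ν).real (Set.Iic x) = ∫ y, μ.real (Set.Iic (x - y)) ∂ν := by
  have measurable_fiber : Measurable fun y => μ (Set.Iic (x - y)) :=
    Antitone.measurable fun _ _ h => measure_mono (Set.Iic_subset_Iic.2 (sub_le_sub_left h x))
  rw [measureReal_def, conv_apply μ ν measurableSet_Iic]
  simp only [Set.preimage_add_const_Iic, measureReal_def]
  exact (integral_toReal measurable_fiber.aemeasurable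
    (.of_forall fun _ => measure_lt_top _ _)).symm

theorem conv_Iio_zero {μ ν : Measure ℝ} [SFinite μ] [SFinite ν] (hμ : μ (Set.Iio 0) = 0)
    (hν : ν (Set.Iio 0) = 0) : (μ ∗ ν) (Set.Iio 0) = 0 := by
  rw [conv_apply μ ν measurableSet_Iio]
  refine lintegral_eq_zero_of_ae_eq_zero ?_
  filter_upwards [measure_eq_zero_iff_ae_notMem.1 hν] with y hy
  rw [Set.preimage_add_const_Iio]
  exact measure_mono_null (Set.Iio_subset_Iio (by simpa using hy)) hμ

theorem IsDensity.integral_eq_intervalIntegral {μ : Measure ℝ} {f : ℝ → ℝ} (hf : IsDensity μ f)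
    (h0 : μ (Set.Iio 0) = 0) {b : ℝ} (hb : 0 ≤ b) {φ : ℝ → ℝ} (hφ : ∀ y, b < y → φ y = 0) :
    ∫ y, φ y ∂μ = ∫ y in (0 : ℝ)..b, φ y * f y := by
  calc ∫ y, φ y ∂μ = ∫ y in Set.Icc 0 b, φ y ∂μ := by
        refine (setIntegral_eq_integral_of_ae_compl_eq_zero ?_).symm
        filter_upwards [measure_eq_zero_iff_ae_notMem.1 h0] with y hy hyb
        exact hφ y (not_le.1 fun h => hyb ⟨not_lt.1 hy, h⟩)
    _ = ∫ y in Set.Icc 0 b, (ENNReal.ofReal (f y)).toReal • φ y := by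
        rw [hf.eq_withDensity, setIntegral_withDensity_eq_setIntegral_toReal_smul
          hf.measurable.ennreal_ofReal (.of_forall fun _ => ENNReal.ofReal_lt_top) _
          measurableSet_Icc]
    _ = ∫ y in (0 : ℝ)..b, φ y * f y := by
        simp only [ENNReal.toReal_ofReal (hf.nonneg _), smul_eq_mul, mul_comm (f _)]
        rw [intervalIntegral.integral_of_le hb, integral_Icc_eq_integral_Ioc]

theorem IsDensity.map_div {μ : Measure ℝ} {f : ℝ → ℝ} (hf : IsDensity μ f) {c : ℝ} (hc : 0 < c) :
    IsDensity (μ.map (· / c)) fun x => c * f (c * x) where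
  measurable := (hf.measurable.comp (measurable_const_mul c)).const_mul c
  nonneg x := mul_nonneg hc.le (hf.nonneg _)
  eq_withDensity := by
    ext s hs
    have hdiv : Measurable fun x : ℝ => x / c := measurable_id.div_const c
    have preimage_preimage : (c * ·) ⁻¹' ((· / c) ⁻¹' s) = s := by
      ext x
      simp [hc.ne']
    calc μ.map (· / c) s = ∫⁻ x in (· / c) ⁻¹' s, ENNReal.ofReal (f x) := by
          rw [Measure.map_apply hdiv hs, hf.eq_withDensity, withDensity_apply _ (hdiv hs)]
      _ = ENNReal.ofReal c * ∫⁻ x in s, ENNReal.ofReal (f (c * x)) := by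
          conv_lhs => rw [← Real.smul_map_volume_mul_left hc.ne']
          rw [Measure.restrict_smul, lintegral_smul_measure, setLIntegral_map (hdiv hs)
            hf.measurable.ennreal_ofReal (measurable_const_mul c), preimage_preimage,
            abs_of_pos hc, smul_eq_mul]
      _ = volume.withDensity (fun x => ENNReal.ofReal (c * f (c * x))) s := by
          simp only [ENNReal.ofReal_mul hc.le]
          rw [withDensity_apply _ hs, lintegral_const_mul]
          exact (hf.measurable.comp (measurable_const_mul c)).ennreal_ofReal

/-- `μ` is carried by `[0, ∞)` and its distribution function has Maclaurin series
`borelTransform u` there: `u` is the Laplace transform of `μ` as a formal series in `X = 1 / s`. -/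
structure HasLaplaceSeries (μ : Measure ℝ) (u : ℝ⟦X⟧) : Prop where
  measure_Iio_zero : μ (Set.Iio 0) = 0
  sumsTo_Iic : SumsTo (borelTransform u) fun x => μ.real (Set.Iic x)

/-- `μ` is carried by `[0, ∞)` and has there a density with Maclaurin series `borelTransform w`. -/
structure HasDensitySeries (μ : Measure ℝ) (w : ℝ⟦X⟧) : Prop where
  measure_Iio_zero : μ (Set.Iio 0) = 0
  exists_density : ∃ f, IsDensity μ f ∧ SumsTo (borelTransform w) f

theorem hasLaplaceSeries_dirac_zero : HasLaplaceSeries (.dirac 0) 1 where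
  measure_Iio_zero := by simp
  sumsTo_Iic := by
    rw [← map_one C, borelTransform_C]
    exact (sumsTo_C 1).congr fun x hx => by simp [measureReal_def, hx]

theorem HasLaplaceSeries.conv {μ ν : Measure ℝ} [IsFiniteMeasure μ] [SFinite ν] {u w : ℝ⟦X⟧}
    (hμ : HasLaplaceSeries μ u) (hν : HasDensitySeries ν w) :
    HasLaplaceSeries (μ ∗ ν) (u * (X * w)) where
  measure_Iio_zero := conv_Iio_zero hμ.measure_Iio_zero hν.measure_Iio_zero
  sumsTo_Iic := by
    obtain ⟨g, hg, hw⟩ := hν.exists_density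
    rw [mul_left_comm]
    refine (hμ.sumsTo_Iic.borelTransform_X_mul_mul hw).congr fun x hx => ?_
    rw [measureReal_conv_Iic, hg.integral_eq_intervalIntegral hν.measure_Iio_zero hx]
    intro y hy
    refine measureReal_mono_null (Set.Iic_subset_Iio.2 (sub_neg.2 hy)) ?_
    simp [measureReal_def, hμ.measure_Iio_zero]

theorem HasDensitySeries.hasLaplaceSeries {μ : Measure ℝ} [SFinite μ] {w : ℝ⟦X⟧}
    (hμ : HasDensitySeries μ w) : HasLaplaceSeries μ (X * w) := by
  simpa using hasLaplaceSeries_dirac_zero.conv hμ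

theorem HasDensitySeries.map_div {μ : Measure ℝ} {w : ℝ⟦X⟧} (hμ : HasDensitySeries μ w) {c : ℝ}
    (hc : 0 < c) : HasDensitySeries (μ.map (· / c)) (C c * rescale c w) where
  measure_Iio_zero := by
    have hdiv : Measurable fun x : ℝ => x / c := measurable_id.div_const c
    rw [Measure.map_apply hdiv measurableSet_Iio]
    convert! hμ.measure_Iio_zero using 2
    ext y
    simp [div_neg_iff, hc, hc.not_gt]
  exists_density := by
    obtain ⟨f, hf, hw⟩ := hμ.exists_density
    refine ⟨_, hf.map_div hc, ?_⟩
    rw [borelTransform_C_mul, borelTransform_rescale]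
    exact (hw.rescale hc.le).C_mul c

theorem HasDensitySeries.hasLaplaceSeries_map_sum {Ω ι : Type*} [MeasurableSpace Ω]
    {P : Measure Ω} [IsProbabilityMeasure P] {ν : ι → Measure ℝ} {w : ι → ℝ⟦X⟧}
    (hν : ∀ i, HasDensitySeries (ν i) (w i)) {Y : ι → Ω → ℝ} (hY : ∀ i, HasLaw (Y i) (ν i) P)
    (hindep : iIndepFun Y P) (s : Finset ι) :
    HasLaplaceSeries (P.map (∑ i ∈ s, Y i)) (∏ i ∈ s, X * w i) := by
  classical
  induction s using Finset.induction_on with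
  | empty =>
    have map_zero : P.map (0 : Ω → ℝ) = .dirac 0 := by
      rw [Pi.zero_def, Measure.map_const, measure_univ, one_smul]
    simpa [map_zero] using hasLaplaceSeries_dirac_zero
  | insert i s hi ih =>
    have aemeasurable_Y (j : ι) : AEMeasurable (Y j) P := (hY j).aemeasurable
    have hadd : P.map (∑ j ∈ insert i s, Y j) = P.map (∑ j ∈ s, Y j) ∗ ν i := by
      rw [Finset.sum_insert hi, add_comm, ← (hY i).map_eq]
      exact (hindep.indepFun_finsetSum_of_notMem₀ aemeasurable_Y hi).map_add_eq_map_conv_map₀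
        (Finset.aemeasurable_sum s fun j _ => aemeasurable_Y j) (aemeasurable_Y i)
    have : SFinite (ν i) := (hY i).map_eq ▸ inferInstance
    rw [hadd, Finset.prod_insert hi, mul_comm]
    exact ih.conv (hν i)

theorem HasMaclaurinExpansion.sumsTo {f : ℝ → ℝ} (hf : HasMaclaurinExpansion f) :
    SumsTo (borelTransform (.mk fun q => iteratedDerivWithin q f (Set.Ici 0) 0)) f := by
  intro x hx
  simp only [coeff_borelTransform, coeff_mk]
  rcases hx.eq_or_lt with rfl | hx
  · convert! hasSum_single (f := fun m : ℕ =>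
      iteratedDerivWithin m f (Set.Ici 0) 0 / (m.factorial : ℝ) * (0 : ℝ) ^ m) 0 ?_ using 1
    · simp
    · exact fun m hm => by simp [hm]
  · exact hf x hx

theorem MemClassF.exists_hasDensitySeries {μ : Measure ℝ} (hμ : MemClassF μ) :
    ∃ w, HasDensitySeries μ w := by
  have := hμ.isProbabilityMeasure
  obtain ⟨f, hf, hexp⟩ := hμ.exists_density
  refine ⟨_, ?_, f, hf, hexp.sumsTo⟩
  refine measure_mono_null Set.Iio_subset_Iic_self ?_
  rw [← ofReal_cdf, hμ.cdf_zero, ENNReal.ofReal_zero]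

theorem measureReal_sampleMax_preimage_Iic {Ω : Type*} [MeasurableSpace Ω] {P : Measure Ω}
    {n : ℕ} [NeZero n] {ν : Fin n → Measure ℝ} {Y : Fin n → Ω → ℝ} (hY : ∀ i, HasLaw (Y i) (ν i) P)
    (hindep : iIndepFun Y P) (x : ℝ) :
    P.real (sampleMax Y ⁻¹' Set.Iic x) = ∏ i, (ν i).real (Set.Iic x) := by
  have preimage_eq : sampleMax Y ⁻¹' Set.Iic x = ⋂ i, Y i ⁻¹' Set.Iic x := by
    ext ω
    simp [sampleMax, ciSup_le_iff (Set.finite_range fun i => Y i ω).bddAbove]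
  have measure_le (i : Fin n) : P (Y i ⁻¹' Set.Iic x) = ν i (Set.Iic x) :=
    (hY i).measure_eq (p := (· ≤ x)) measurableSet_Iic
  rw [preimage_eq, measureReal_def, hindep.meas_iInter fun i => ⟨Set.Iic x, measurableSet_Iic, rfl⟩,
    ENNReal.toReal_prod]
  simp only [measure_le, measureReal_def]

theorem HasDensitySeries.hasLaplaceSeries_map_harmonicSum {Ω : Type*} [MeasurableSpace Ω]
    {P : Measure Ω} [IsProbabilityMeasure P] {μ : Measure ℝ} {w : ℝ⟦X⟧} (hw : HasDensitySeries μ w)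
    {n : ℕ} {Y : Fin n → Ω → ℝ} (hY : ∀ i, HasLaw (Y i) μ P) (hindep : iIndepFun Y P) :
    HasLaplaceSeries (P.map (harmonicSum Y)) (harmonicProd n (X * w)) := by
  have hdiv (i : Fin n) : Measurable fun x : ℝ => x / ((i : ℝ) + 1) := measurable_id.div_const _
  have series_eq : harmonicProd n (X * w) =
      ∏ i : Fin n, X * (C ((i : ℝ) + 1) * rescale ((i : ℝ) + 1) w) := by
    rw [harmonicProd, ← Fin.prod_univ_eq_prod_range fun i => rescale ((i : ℝ) + 1) (X * w)]
    refine Finset.prod_congr rfl fun i _ => ?_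
    rw [map_mul, rescale_X]
    ring
  have sum_eq : harmonicSum Y = ∑ i, (fun x : ℝ => x / (((i : Fin n) : ℝ) + 1)) ∘ Y i := by
    ext ω
    simp [harmonicSum]
  rw [series_eq, sum_eq]
  exact HasDensitySeries.hasLaplaceSeries_map_sum (fun i => hw.map_div (by positivity))
    (fun i => (HasLaw.mk (hdiv i).aemeasurable rfl).comp (hY i)) (hindep.comp _ hdiv) Finset.univ

theorem HasDensitySeries.renyiIdentity_of_identDistrib {Ω : Type*} [MeasurableSpace Ω]
    {P : Measure Ω} [IsProbabilityMeasure P] {μ : Measure ℝ} {w : ℝ⟦X⟧} (hw : HasDensitySeries μ w)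
    {n : ℕ} [NeZero n] {Y : Fin n → Ω → ℝ} (hY : ∀ i, HasLaw (Y i) μ P) (hindep : iIndepFun Y P)
    (hid : IdentDistrib (harmonicSum Y) (sampleMax Y) P P) : RenyiIdentity n (X * w) := by
  have : IsProbabilityMeasure μ := (hY 0).isProbabilityMeasure_iff.1 ‹_›
  refine (hw.hasLaplaceSeries_map_harmonicSum hY hindep).sumsTo_Iic.unique ?_
  refine (hw.hasLaplaceSeries.sumsTo_Iic.pow n).congr fun x _ => ?_
  calc μ.real (Set.Iic x) ^ n = P.real (sampleMax Y ⁻¹' Set.Iic x) := by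
        simpa using (measureReal_sampleMax_preimage_Iic hY hindep x).symm
    _ = (P.map (harmonicSum Y)).real (Set.Iic x) := by
        rw [measureReal_def, measureReal_def, ← hid.measure_mem_eq measurableSet_Iic,
          Measure.map_apply_of_aemeasurable hid.aemeasurable_fst measurableSet_Iic]

theorem HasLaplaceSeries.add_mul_measureReal_Iic {μ : Measure ℝ} {a ρ : ℝ}
    (h : HasLaplaceSeries μ (expLaplaceSeries a ρ)) {x : ℝ} (hx : 0 ≤ x) :
    a + ρ * μ.real (Set.Iic x) = a * Real.exp (ρ * x) := by
  have hF := (sumsTo_C a).add (h.sumsTo_Iic.C_mul ρ)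
  rw [borelTransform_expLaplaceSeries] at hF
  exact (hF x hx).unique ((sumsTo_rescale_exp ρ).C_mul a x hx)

theorem HasLaplaceSeries.ratio_neg {μ : Measure ℝ} [IsProbabilityMeasure μ] {a ρ : ℝ}
    (h : HasLaplaceSeries μ (expLaplaceSeries a ρ)) : ρ < 0 := by
  by_contra! hρ
  have coeff_borel (m : ℕ) : coeff (m + 1) (borelTransform (expLaplaceSeries a ρ)) =
      a * (ρ ^ m / (m + 1).factorial) := by
    rw [coeff_borelTransform, coeff_succ_expLaplaceSeries, mul_div_assoc]
  have coeff_zero_borel : coeff 0 (borelTransform (expLaplaceSeries a ρ)) = 0 := by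
    simp [constantCoeff_expLaplaceSeries]
  rcases le_or_gt a 0 with ha | ha
  · have measure_nonpos (x : ℝ) (hx : 0 ≤ x) : μ.real (Set.Iic x) ≤ 0 := by
      refine (h.sumsTo_Iic x hx).nonpos fun m => ?_
      refine mul_nonpos_of_nonpos_of_nonneg ?_ (pow_nonneg hx m)
      cases m with
      | zero => exact coeff_zero_borel.le
      | succ m => exact coeff_borel m ▸ mul_nonpos_of_nonpos_of_nonneg ha (by positivity)
    simp only [← cdf_eq_real] at measure_nonpos
    exact zero_lt_one.not_ge <| le_of_tendsto (tendsto_cdf_atTop μ)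
      ((eventually_ge_atTop 0).mono measure_nonpos)
  · have le_measure : coeff 1 (borelTransform (expLaplaceSeries a ρ)) * (2 / a) ^ 1 ≤
        μ.real (Set.Iic (2 / a)) := by
      refine le_hasSum (h.sumsTo_Iic (2 / a) (by positivity)) 1 fun m _ => ?_
      cases m with
      | zero => simp [coeff_zero_borel]
      | succ m => rw [coeff_borel]; positivity
    have : a * (2 / a) ≤ 1 := by
      simpa [coeff_borel 0] using le_measure.trans measureReal_le_one
    rw [mul_div_cancel₀ _ ha.ne'] at this
    norm_num at this

theorem HasLaplaceSeries.eq_expMeasure {μ : Measure ℝ} [IsProbabilityMeasure μ] {a ρ : ℝ}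
    (h : HasLaplaceSeries μ (expLaplaceSeries a ρ)) : μ = expMeasure (-ρ) := by
  have hρ : 0 < -ρ := neg_pos.2 h.ratio_neg
  have hcdf (x : ℝ) (hx : 0 ≤ x) : a + ρ * cdf μ x = a * Real.exp (ρ * x) :=
    cdf_eq_real μ x ▸ h.add_mul_measureReal_Iic hx
  have hlim : Tendsto (fun x => a * Real.exp (ρ * x)) atTop (𝓝 (a + ρ * 1)) :=
    (((tendsto_cdf_atTop μ).const_mul ρ).const_add a).congr'
      ((eventually_ge_atTop 0).mono hcdf)
  have hlim_zero : Tendsto (fun x => a * Real.exp (ρ * x)) atTop (𝓝 0) := by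
    simpa using (Real.tendsto_exp_atBot.comp
      (tendsto_id.const_mul_atTop_of_neg h.ratio_neg)).const_mul a
  obtain rfl : a = -ρ := by linarith [tendsto_nhds_unique hlim hlim_zero]
  have := isProbabilityMeasure_expMeasure hρ
  refine Measure.eq_of_cdf _ _ (StieltjesFunction.ext fun x => ?_)
  rw [cdf_expMeasure_eq hρ]
  split_ifs with hx
  · refine mul_left_cancel₀ h.ratio_neg.ne ?_
    rw [neg_mul ρ x, neg_neg]
    linarith [hcdf x hx]
  · rw [cdf_eq_real, measureReal_def,
      measure_mono_null (Set.Iic_subset_Iio.2 (not_le.1 hx)) h.measure_Iio_zero,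
      ENNReal.toReal_zero]

end Laws

theorem mainTheorem4 {Ω : Type*} [MeasurableSpace Ω] (P : MeasureTheory.Measure Ω)
    [MeasureTheory.IsProbabilityMeasure P] (μ : MeasureTheory.Measure ℝ) (hμ : MemClassF μ)
    (n : ℕ) (hn : 2 ≤ n) (X : Fin n → Ω → ℝ)
    (hlaw : ∀ i, ProbabilityTheory.HasLaw (X i) μ P)
    (hindep : ProbabilityTheory.iIndepFun X P)
    (hX : ProbabilityTheory.IdentDistrib (harmonicSum X) (sampleMax X) P P) :
    ∃ r : ℝ, 0 < r ∧ μ = ProbabilityTheory.expMeasure r := by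
  have := hμ.isProbabilityMeasure
  have : NeZero n := ⟨by omega⟩
  obtain ⟨w, hw⟩ := hμ.exists_hasDensitySeries
  have hrenyi := hw.renyiIdentity_of_identDistrib hlaw hindep hX
  obtain ⟨a, ρ, hseries⟩ := hrenyi.exists_eq_expLaplaceSeries hn (by simp)
  have hlaplace := hseries ▸ hw.hasLaplaceSeries
  exact ⟨-ρ, neg_pos.2 hlaplace.ratio_neg, hlaplace.eq_expMeasure⟩
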